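/- Consider the Engel group $\mathbb R^4\ni q=(x_1,x_2,y,z)$ with the left-invariant fields $$X_1=\partial_{x_1}-\tfrac{x_2}{2}\partial_y,\qquad X_2=\partial_{x_2}+\tfrac{x_1}{2}\partial_y+\tfrac{x_1^2+x_2^2}{2}\partial_z$$ and the sub-Lorentzian metric $g(X_1,X_1)=-1$, $g(X_2,X_2)=1$, $g(X_1,X_2)=0$. Parametrize the initial covectors of timelike normal extremals ($H=-\frac12$, $h_1>0$) by $C=\{\lambda=(\theta,c,\alpha)\in\mathbb R^3\}$, where $h_1=\cosh\theta$, $h_2=\sinh\theta$, $h_3=c$, $h_4=\alpha$. The extremals are the solutions of $$\dot\theta=-c,\quad \dot c=-\alpha\cosh\theta,\quad \dot\alpha=0,\quad \dot q=-\cosh\theta\,X_1(q)+\sinh\theta\,X_2(q),\quad q(0)=0,$$ and $\mathrm{Exp}(\lambda,t)=q(t)$ for the solution with initial covector $\lambda$. Let $e^{t\vec H_v}$ be the flow of the subsystem for $(\theta,c,\alpha)$, and let $C^{\pm}=\{\lambda\in C:\pm\alpha>0\}$. For $\lambda\in C^+\cup C^-$ put $E=\frac{c^2}{2}-\alpha\sinh\theta$,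 $\varkappa=\sqrt{\tfrac12\sqrt{E^2+\alpha^2}}$ and let $k\in(0,1)$ be given by $k^2=\frac12+\frac{E}{4\varkappa^2}$. Let $\mathrm{sn},\mathrm{cn},\mathrm{dn}$ be the Jacobi functions of modulus $k$, $K=K(k)$ the complete elliptic integral of the first kind, and $\mathrm E(u)=\int_0^u\mathrm{dn}^2s\,ds$. For $\lambda\in C^+$ let $\psi_0\in(-K,K)$ be the number with $$c=-2\varkappa\,\frac{\mathrm{sn}\,\psi_0}{\mathrm{cn}\,\psi_0}\,\mathrm{dn}\,\psi_0,\quad \sinh\theta=\frac{2\varkappa^2\big(1-k^2(1+\mathrm{cn}^4\psi_0)\big)}{\alpha\,\mathrm{cn}^2\psi_0},\quad \cosh\theta=\frac{2\varkappa^2\big(1-k^2(1-\mathrm{cn}^4\psi_0)\big)}{\alpha\,\mathrm{cn}^2\psi_0};$$ for $\lambda\in C^-$ let $\psi_0$ be the number assigned to $(-\theta,-c,-\alpha)\in C^+$. Let $t_{\sup}(\lambda)=(K-\psi_0)/\varkappa$ for $\lambda\in C^+\cup C^-$ and $t_{\sup}(\lambda)=+\infty$ if $\alpha=0$. Let $N=\{(\lambda,t):\lambda\in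 C,\ 0<t<t_{\sup}(\lambda)\}$ and $N^\pm=\{(\lambda,t)\in N:\lambda\in C^+\cup C^-\}$. Define on $C$ the maps $\varepsilon^1(\theta,c,\alpha)=(-\theta,-c,-\alpha)$, $\varepsilon^2(\theta,c,\alpha)=(\theta,-c,\alpha)$, $\varepsilon^3(\theta,c,\alpha)=(-\theta,c,-\alpha)$. For $(\lambda,t)\in N$ let $\lambda^1=\varepsilon^1(\lambda)$, $\lambda^2=\varepsilon^2(e^{t\vec H_v}\lambda)$, $\lambda^3=\varepsilon^3(e^{t\vec H_v}\lambda)$, and for $i=1,2,3$ let $$\mathrm{MAX}^i=\{(\lambda,t)\in N:\lambda^i\ne\lambda,\ \mathrm{Exp}(\lambda^i,t)=\mathrm{Exp}(\lambda,t)\}.$$ **Theorem.** 1. $\mathrm{MAX}^2\cap N^\pm=\emptyset$. 2. For every $\lambda\in C^+\cup C^-$ and every $p\in(0,K(k))$, $$f_y(p)=-16\varkappa^4k^4\,\mathrm{cn}^3p\,\mathrm{dn}\,p\,\mathrm{sn}\,p+\big(16\varkappa^4k^2\,\mathrm E(p)-\alpha^2p\big)\big(\mathrm{dn}^2p-k^2\,\mathrm{cn}^2p\,\mathrm{sn}^2p\big)>0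 .$$ 3. For every $\lambda\in C^+\cup C^-$ and every $t\in(0,t_{\sup}(\lambda))$, the pair $(\lambda,t)$ belongs to none of $\mathrm{MAX}^1,\mathrm{MAX}^2,\mathrm{MAX}^3$; that is, there are no Maxwell times corresponding to $\varepsilon^1,\varepsilon^2,\varepsilon^3$ before $t_{\sup}(\lambda)$. -/

import Mathlib

noncomputable section

namespace EngelTimelike

open Real Set

/-! ### Jacobi elliptic functions of a real argument, with modulus `k ∈ (0, 1)` -/

/-- Incomplete elliptic integral of the first kind, as a function of the amplitude. -/
def ellipticF (k φ : ℝ) : ℝ := ∫ t in (0 : ℝ)..φ, 1 / √(1 - k ^ 2 * sin t ^ 2)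

/-- Complete elliptic integral of the first kind. -/
def ellipticK (k : ℝ) : ℝ := ellipticF k (π / 2)

/-- The amplitude: the inverse of the bijection `ellipticF k : ℝ → ℝ`. -/
def am (k u : ℝ) : ℝ := Function.invFun (ellipticF k) u

def sn (k u : ℝ) : ℝ := sin (am k u)

def cn (k u : ℝ) : ℝ := cos (am k u)

def dn (k u : ℝ) : ℝ := √(1 - k ^ 2 * sn k u ^ 2)

/-- `E(u) = ∫₀ᵘ dn² t dt`. -/
def jacobiE (k u : ℝ) : ℝ := ∫ t in (0 : ℝ)..u, dn k t ^ 2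

/-! ### The Engel group: the horizontal frame in coordinates `(x₁, x₂, y, z)` of `ℝ⁴` -/

/-- `X₁ = ∂/∂x₁ - (x₂/2) ∂/∂y`. -/
def X₁ (q : Fin 4 → ℝ) : Fin 4 → ℝ := ![1, 0, -(q 1 / 2), 0]

/-- `X₂ = ∂/∂x₂ + (x₁/2) ∂/∂y + ((x₁² + x₂²)/2) ∂/∂z`. -/
def X₂ (q : Fin 4 → ℝ) : Fin 4 → ℝ := ![0, 1, q 0 / 2, (q 0 ^ 2 + q 1 ^ 2) / 2]

/-! ### Timelike normal extremals starting at the identity -/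

/-- The set `C` of initial covectors on the level `H = -1/2` with `h₁ > 0`, in the coordinates
`h₁ = cosh θ`, `h₂ = sinh θ`, `h₃ = c`, `h₄ = α`. -/
@[ext]
structure Covector where
  θ : ℝ
  c : ℝ
  α : ℝ

instance : Inhabited Covector := ⟨⟨0, 0, 0⟩⟩

/-- `(θ, c)` solves the vertical subsystem `θ' = -c`, `c' = -α cosh θ` on `[0, T]`, with `α`
constant and initial covector `l`. -/
structure IsVertical (l : Covector) (T : ℝ) (θ c : ℝ → ℝ) : Prop where
  θ_zero : θ 0 = l.θ
  c_zero : c 0 = l.c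
  deriv_θ : ∀ t ∈ Icc 0 T, HasDerivWithinAt θ (-c t) (Icc 0 T) t
  deriv_c : ∀ t ∈ Icc 0 T, HasDerivWithinAt c (-l.α * cosh (θ t)) (Icc 0 T) t

/-- `(θ, c, α, q)` solves the normal Hamiltonian system on `[0, T]` with initial covector `l` and
initial point the identity: the vertical subsystem together with
`q' = -cosh θ X₁(q) + sinh θ X₂(q)`. -/
structure IsExtremal (l : Covector) (T : ℝ) (θ c : ℝ → ℝ) (q : ℝ → Fin 4 → ℝ) : Prop
    extends IsVertical l T θ c where
  q_zero : q 0 = 0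
  deriv_q : ∀ t ∈ Icc 0 T,
    HasDerivWithinAt q (-cosh (θ t) • X₁ (q t) + sinh (θ t) • X₂ (q t)) (Icc 0 T) t

/-- The flow `e^{tH_v}` of the vertical subsystem: the value at time `t` of its solution with
initial value `l` (an arbitrary fixed value if there is no solution on `[0, t]`). -/
def verticalFlow (l : Covector) (t : ℝ) : Covector :=
  Classical.epsilon fun m => ∃ θ c, IsVertical l t θ c ∧ m = ⟨θ t, c t, l.α⟩

/-- The exponential mapping: the point `q(t)` of the extremal trajectory with initial covector `l`
(an arbitrary fixed point, the same for all such `l` and `t`, if there is no solution on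
`[0, t]`). -/
def Exp (l : Covector) (t : ℝ) : Fin 4 → ℝ :=
  Classical.epsilon fun p => ∃ θ c q, IsExtremal l t θ c q ∧ p = q t

/-! ### Subsets of `C`, elliptic coordinates, and the domain of the exponential mapping -/

/-- `C⁺`. -/
def Cplus : Set Covector := {l | 0 < l.α}

/-- `C⁻`. -/
def Cminus : Set Covector := {l | l.α < 0}

/-- The energy integral `E = c²/2 - α sinh θ`. -/
def Covector.energy (l : Covector) : ℝ := l.c ^ 2 / 2 - l.α * sinh l.θ

/-- `æ = √(√(E² + α²)/2)`. -/
def Covector.ae (l : Covector) : ℝ := √(√(l.energy ^ 2 + l.α ^ 2) / 2)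

/-- The modulus `k ∈ (0, 1)`, with `k² = 1/2 + E/(4æ²)`. -/
def Covector.k (l : Covector) : ℝ := √(1 / 2 + l.energy / (4 * l.ae ^ 2))

/-- `ψ = æ φ ∈ (-K, K)`, where `φ` is the rectifying coordinate of `l ∈ C⁺`. -/
structure IsPhase (l : Covector) (ψ : ℝ) : Prop where
  mem : ψ ∈ Ioo (-ellipticK l.k) (ellipticK l.k)
  c_eq : l.c = -2 * l.ae * (sn l.k ψ / cn l.k ψ) * dn l.k ψ
  sinh_eq : sinh l.θ =
    2 * l.ae ^ 2 * (1 - l.k ^ 2 * (1 + cn l.k ψ ^ 4)) / (l.α * cn l.k ψ ^ 2)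
  cosh_eq : cosh l.θ =
    2 * l.ae ^ 2 * (1 - l.k ^ 2 * (1 - cn l.k ψ ^ 4)) / (l.α * cn l.k ψ ^ 2)

/-- `ε¹ (θ, c, α) = (-θ, -c, -α)`. -/
def eps1 (l : Covector) : Covector := ⟨-l.θ, -l.c, -l.α⟩

/-- `ε² (θ, c, α) = (θ, -c, α)`. -/
def eps2 (l : Covector) : Covector := ⟨l.θ, -l.c, l.α⟩

/-- `ε³ (θ, c, α) = (-θ, c, -α)`. -/
def eps3 (l : Covector) : Covector := ⟨-l.θ, l.c, -l.α⟩

/-- The initial phase `ψ₀` of `l ∈ C⁺ ∪ C⁻`; the coordinates are carried from `C⁺` to `C⁻`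
by `ε¹`. -/
def Covector.ψ₀ (l : Covector) : ℝ :=
  if 0 < l.α then Classical.epsilon (IsPhase l) else Classical.epsilon (IsPhase (eps1 l))

/-- `t_sup = (K(k) - ψ₀)/æ` if `α ≠ 0`, and `+∞` if `α = 0`. -/
def tSup (l : Covector) : EReal :=
  if l.α = 0 then ⊤ else (((ellipticK l.k - l.ψ₀) / l.ae : ℝ) : EReal)

/-- The domain `N` of the exponential mapping. -/
def N : Set (Covector × ℝ) := {ν | 0 < ν.2 ∧ (ν.2 : EReal) < tSup ν.1}

/-- `N^±`, the part of `N` over `C⁺ ∪ C⁻`. -/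
def Npm : Set (Covector × ℝ) := {ν | ν ∈ N ∧ ν.1 ∈ Cplus ∪ Cminus}

/-! ### Reflections in the domain of the exponential mapping, and Maxwell sets -/

/-- `λ¹ = ε¹(λ)`. -/
def reflect1 (l : Covector) (_t : ℝ) : Covector := eps1 l

/-- `λ² = ε²(e^{tH_v} λ)`. -/
def reflect2 (l : Covector) (t : ℝ) : Covector := eps2 (verticalFlow l t)

/-- `λ³ = ε³(e^{tH_v} λ)`. -/
def reflect3 (l : Covector) (t : ℝ) : Covector := eps3 (verticalFlow l t)

/-- The Maxwell set of a reflection `(λ, t) ↦ (r λ t, t)`. -/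
def maxwellSet (r : Covector → ℝ → Covector) : Set (Covector × ℝ) :=
  {ν | ν ∈ N ∧ r ν.1 ν.2 ≠ ν.1 ∧ Exp (r ν.1 ν.2) ν.2 = Exp ν.1 ν.2}

def MAX1 : Set (Covector × ℝ) := maxwellSet reflect1

def MAX2 : Set (Covector × ℝ) := maxwellSet reflect2

def MAX3 : Set (Covector × ℝ) := maxwellSet reflect3

/-- The function `f_y(p)`, with `æ`, `k`, `α` those of the covector `l`. -/
def fy (l : Covector) (p : ℝ) : ℝ :=
  -16 * l.ae ^ 4 * l.k ^ 4 * cn l.k p ^ 3 * dn l.k p * sn l.k p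
    + (16 * l.ae ^ 4 * l.k ^ 2 * jacobiE l.k p - l.α ^ 2 * p)
      * (dn l.k p ^ 2 - l.k ^ 2 * cn l.k p ^ 2 * sn l.k p ^ 2)

end EngelTimelike

end

namespace EngelTimelike

open Real Set

/-! ### Jacobi elliptic functions -/

/-! No Maxwell coincidence is computed in elliptic functions. The bound `tSup` serves only to
guarantee that the extremal exists on `[0, t]`; elliptic functions give an explicit vertical
solution up to that time, and quadratures lift it to the group. Existence and uniqueness then
identify the values chosen in `Exp` and `verticalFlow`.

At the endpoint `(x₁, x₂, y, z)`, `ε¹` gives `(x₁, -x₂, -y, -z)`, while time reversal, which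
realises `ε²`, gives `(x₁, x₂, -y, z - x₁y)`; `ε³` is their composition. A Maxwell point thus needs
`y = 0` for `ε²`, and `x₂ = 0` with `2z = x₁y` for `ε¹` and `ε³`.

For `y`, the arc is viewed from its midpoint `m`. If `c m = 0`, the arc is symmetric and the
reflected covector is the original one. Otherwise `IsVertical.sub_div_cosh_eq` makes `θ (m + s) - θ
(m - s)` keep one sign, and since chords are timelike the `y` of the arc between symmetric times is
strictly monotone in `s` (`IsExtremal.y_ne_zero`).

For `x₂`, the velocity `c` is used as parameter. Then `x₂ = 0` says that a certain even function has
mean zero, and `2z - x₁y` is, up to a nonzero factor, its moment against `(v - a)(v - b)`; a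
reflection argument makes that moment nonzero (`integral_mul_ne_zero`).

Positivity of `fy` is independent of this: after division by the positive second factor, the
expression vanishes at `0` and has positive derivative on `(0, K)`. -/

theorem one_sub_sq_mul_sin_sq_pos {k : ℝ} (hk : k ^ 2 < 1) (φ : ℝ) :
    0 < 1 - k ^ 2 * sin φ ^ 2 := by
  nlinarith [sin_sq_le_one φ, sq_nonneg k, sq_nonneg (sin φ)]

theorem hasDerivAt_ellipticF {k : ℝ} (hk : k ^ 2 < 1) (φ : ℝ) :
    HasDerivAt (ellipticF k) (1 / √(1 - k ^ 2 * sin φ ^ 2)) φ := by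
  have hc : Continuous fun t : ℝ => 1 / √(1 - k ^ 2 * sin t ^ 2) :=
    continuous_const.div (by fun_prop)
      fun t => (sqrt_pos.2 (one_sub_sq_mul_sin_sq_pos hk t)).ne'
  exact (hc.integral_hasStrictDerivAt 0 φ).hasDerivAt

theorem one_le_one_div_sqrt {k : ℝ} (hk : k ^ 2 < 1) (φ : ℝ) :
    1 ≤ 1 / √(1 - k ^ 2 * sin φ ^ 2) := by
  rw [le_div_iff₀ (sqrt_pos.2 (one_sub_sq_mul_sin_sq_pos hk φ)), one_mul]
  refine sqrt_le_iff.2 ⟨zero_le_one, ?_⟩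
  nlinarith [mul_nonneg (sq_nonneg k) (sq_nonneg (sin φ))]

theorem continuous_ellipticF {k : ℝ} (hk : k ^ 2 < 1) : Continuous (ellipticF k) :=
  continuous_iff_continuousAt.2 fun φ => (hasDerivAt_ellipticF hk φ).continuousAt

theorem ellipticF_zero (k : ℝ) : ellipticF k 0 = 0 := by simp [ellipticF]

theorem ellipticF_neg (k φ : ℝ) : ellipticF k (-φ) = -ellipticF k φ := by
  have h := intervalIntegral.integral_comp_neg (a := (0 : ℝ)) (b := φ)
    (fun t => 1 / √(1 - k ^ 2 * sin t ^ 2))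
  simp only [sin_neg, even_two, Even.neg_pow, neg_zero] at h
  rw [ellipticF, ellipticF, h, intervalIntegral.integral_symm]

theorem strictMono_ellipticF {k : ℝ} (hk : k ^ 2 < 1) : StrictMono (ellipticF k) :=
  strictMono_of_hasDerivAt_pos (hasDerivAt_ellipticF hk)
    fun φ => one_pos.trans_le (one_le_one_div_sqrt hk φ)

theorem monotone_ellipticF_sub {k : ℝ} (hk : k ^ 2 < 1) :
    Monotone fun φ => ellipticF k φ - φ :=
  monotone_of_hasDerivAt_nonneg (fun φ => (hasDerivAt_ellipticF hk φ).sub (hasDerivAt_id φ))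
    fun φ => sub_nonneg.2 (one_le_one_div_sqrt hk φ)

theorem surjective_ellipticF {k : ℝ} (hk : k ^ 2 < 1) : Function.Surjective (ellipticF k) := by
  have hm := monotone_ellipticF_sub hk
  refine (continuous_ellipticF hk).surjective ?_ ?_
  · refine Filter.tendsto_atTop_mono' _ ?_ Filter.tendsto_id
    filter_upwards [Filter.eventually_ge_atTop 0] with φ hφ
    have := hm hφ
    simp only [ellipticF_zero] at this
    simp only [id]; linarith
  · refine Filter.tendsto_atBot_mono' _ ?_ Filter.tendsto_id
    filter_upwards [Filter.eventually_le_atBot 0] with φ hφ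
    have := hm hφ
    simp only [ellipticF_zero] at this
    simp only [id]; linarith

theorem am_ellipticF {k : ℝ} (hk : k ^ 2 < 1) (φ : ℝ) : am k (ellipticF k φ) = φ :=
  Function.leftInverse_invFun (strictMono_ellipticF hk).injective φ

theorem ellipticF_am {k : ℝ} (hk : k ^ 2 < 1) (u : ℝ) : ellipticF k (am k u) = u :=
  Function.rightInverse_invFun (surjective_ellipticF hk) u

theorem continuous_am {k : ℝ} (hk : k ^ 2 < 1) : Continuous (am k) := by
  let e := (strictMono_ellipticF hk).orderIsoOfSurjective _ (surjective_ellipticF hk)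
  have : am k = e.symm := by
    funext u
    apply e.injective
    rw [e.apply_symm_apply]
    exact ellipticF_am hk u
  rw [this]
  exact e.symm.continuous

theorem dn_pos {k : ℝ} (hk : k ^ 2 < 1) (u : ℝ) : 0 < dn k u :=
  sqrt_pos.2 (one_sub_sq_mul_sin_sq_pos hk _)

theorem hasDerivAt_am {k : ℝ} (hk : k ^ 2 < 1) (u : ℝ) : HasDerivAt (am k) (dn k u) u := by
  have h := (hasDerivAt_ellipticF hk (am k u)).of_local_left_inverse
    (continuous_am hk).continuousAt (by have := dn_pos hk u; unfold dn sn at this; positivity)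
    (Filter.Eventually.of_forall (ellipticF_am hk))
  simpa [dn, sn] using h

theorem hasDerivAt_sn {k : ℝ} (hk : k ^ 2 < 1) (u : ℝ) :
    HasDerivAt (sn k) (cn k u * dn k u) u := (hasDerivAt_am hk u).sin

theorem hasDerivAt_cn {k : ℝ} (hk : k ^ 2 < 1) (u : ℝ) :
    HasDerivAt (cn k) (-sn k u * dn k u) u := (hasDerivAt_am hk u).cos

theorem dn_sq {k : ℝ} (hk : k ^ 2 < 1) (u : ℝ) : dn k u ^ 2 = 1 - k ^ 2 * sn k u ^ 2 :=
  sq_sqrt (one_sub_sq_mul_sin_sq_pos hk _).le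

theorem sn_sq (k u : ℝ) : sn k u ^ 2 = 1 - cn k u ^ 2 := sin_sq _

theorem hasDerivAt_dn {k : ℝ} (hk : k ^ 2 < 1) (u : ℝ) :
    HasDerivAt (dn k) (-k ^ 2 * sn k u * cn k u) u := by
  have h := ((((hasDerivAt_sn hk u).pow 2).const_mul (k ^ 2)).const_sub 1).sqrt
    (one_sub_sq_mul_sin_sq_pos hk _).ne'
  refine h.congr_deriv ?_
  have := dn_pos hk u
  change _ / (2 * dn k u) = _
  field_simp
  ring

theorem am_mem_Ioo {k : ℝ} (hk : k ^ 2 < 1) {u : ℝ} (hu : u ∈ Ioo (-ellipticK k) (ellipticK k)) :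
    am k u ∈ Ioo (-(π / 2)) (π / 2) := by
  rw [← ellipticF_am hk u, ellipticK, ← ellipticF_neg] at hu
  exact ⟨(strictMono_ellipticF hk).lt_iff_lt.1 hu.1, (strictMono_ellipticF hk).lt_iff_lt.1 hu.2⟩

theorem cn_pos {k : ℝ} (hk : k ^ 2 < 1) {u : ℝ} (hu : u ∈ Ioo (-ellipticK k) (ellipticK k)) :
    0 < cn k u := cos_pos_of_mem_Ioo (am_mem_Ioo hk hu)

theorem am_zero {k : ℝ} (hk : k ^ 2 < 1) : am k 0 = 0 := by
  simpa [ellipticF_zero] using am_ellipticF hk 0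

theorem hasDerivAt_jacobiE {k : ℝ} (hk : k ^ 2 < 1) (u : ℝ) :
    HasDerivAt (jacobiE k) (dn k u ^ 2) u := by
  have hc : Continuous fun t : ℝ => dn k t ^ 2 :=
    (continuous_iff_continuousAt.2 fun t => (hasDerivAt_dn hk t).continuousAt).pow 2
  exact (hc.integral_hasStrictDerivAt 0 u).hasDerivAt

theorem one_sub_sq_mul_one_sub_pow_pos {k : ℝ} (hk : k ^ 2 < 1) (x : ℝ) :
    0 < 1 - k ^ 2 * (1 - x ^ 4) := by
  nlinarith [mul_nonneg (sq_nonneg k) (sq_nonneg (x ^ 2))]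

/-- The inequality behind the positivity of `f_y`, after division by the positive factor
`dn² - k² cn² sn² = 1 - k² (1 - cn⁴)`. -/
theorem cn_pow_mul_lt_jacobiE {k : ℝ} (hk : k ^ 2 < 1) (hk0 : k ≠ 0) {p : ℝ}
    (hp : p ∈ Ioo 0 (ellipticK k)) :
    k ^ 2 * (cn k p ^ 3 * sn k p * dn k p) / (1 - k ^ 2 * (1 - cn k p ^ 4)) <
      jacobiE k p - (1 - k ^ 2) * p := by
  set D : ℝ → ℝ := fun u => 1 - k ^ 2 * (1 - cn k u ^ 4) with hD
  have hDpos : ∀ u, 0 < D u := fun u => one_sub_sq_mul_one_sub_pow_pos hk _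
  set G : ℝ → ℝ := fun u => jacobiE k u - (1 - k ^ 2) * u
    - k ^ 2 * (cn k u ^ 3 * sn k u * dn k u) / D u with hG
  -- Dividing by `D` is what removes `jacobiE` from the derivative, which collapses to a single term
  -- positive on `(0, K)`.
  have hGd : ∀ u, HasDerivAt G
      (4 * k ^ 2 * (1 - k ^ 2) * cn k u ^ 2 * sn k u ^ 2 * dn k u ^ 2 / D u ^ 2) u := by
    intro u
    have hs := hasDerivAt_sn hk u
    have hc := hasDerivAt_cn hk u
    have hd := hasDerivAt_dn hk u
    have hDd : HasDerivAt D _ u := (((hc.pow 4).const_sub 1).const_mul (k ^ 2)).const_sub 1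
    have h := ((hasDerivAt_jacobiE hk u).sub ((hasDerivAt_id u).const_mul (1 - k ^ 2))).sub
      (((((hc.pow 3).mul hs).mul hd).const_mul (k ^ 2)).div hDd (hDpos u).ne')
    refine h.congr_deriv ?_
    have hne := (hDpos u).ne'
    simp only [Pi.mul_apply, Pi.pow_apply]
    field_simp
    simp only [hD]
    have e1 := dn_sq hk u
    have e2 := sn_sq k u
    ring_nf
    simp only [show dn k u ^ 2 = 1 - k ^ 2 * (1 - cn k u ^ 2) by rw [e1, e2], e2]
    ring
  have hmono : StrictMonoOn G (Icc 0 p) := by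
    refine strictMonoOn_of_hasDerivWithinAt_pos (convex_Icc 0 p)
      (fun u _ => (hGd u).continuousAt.continuousWithinAt)
      (fun u _ => (hGd u).hasDerivWithinAt) ?_
    intro u hu
    rw [interior_Icc] at hu
    have hK : 0 < ellipticK k := hp.1.trans hp.2
    have hu' : u ∈ Ioo (-ellipticK k) (ellipticK k) :=
      ⟨by linarith [hu.1], hu.2.trans hp.2⟩
    have h1 := cn_pos hk hu'
    have h2 := dn_pos hk u
    have h4 : 0 < am k u := by
      rw [← (strictMono_ellipticF hk).lt_iff_lt, ellipticF_am hk, ellipticF_zero]; exact hu.1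
    have h3 : 0 < sn k u :=
      sin_pos_of_pos_of_lt_pi h4 (by linarith [(am_mem_Ioo hk hu').2, pi_pos])
    have h5 : 0 < 1 - k ^ 2 := by linarith
    have h6 := hDpos u
    positivity
  have h := hmono (left_mem_Icc.2 hp.1.le) (right_mem_Icc.2 hp.1.le) hp.1
  have h0 : G 0 = 0 := by simp [hG, jacobiE, sn, am_zero hk]
  rw [h0] at h
  simp only [hG, hD] at h
  linarith

/-! ### The parameters of a covector -/

theorem Covector.ae_pos {l : Covector} (h : l.α ≠ 0) : 0 < l.ae := by
  unfold Covector.ae; positivity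

theorem Covector.four_mul_ae_pow {l : Covector} :
    4 * l.ae ^ 4 = l.energy ^ 2 + l.α ^ 2 := by
  have h1 : l.ae ^ 2 = √(l.energy ^ 2 + l.α ^ 2) / 2 := sq_sqrt (by positivity)
  have h2 : l.ae ^ 4 = (l.ae ^ 2) ^ 2 := by ring
  rw [h2, h1, div_pow, sq_sqrt (by positivity)]
  ring

theorem Covector.abs_energy_lt {l : Covector} (h : l.α ≠ 0) : |l.energy| < 2 * l.ae ^ 2 := by
  apply abs_lt_of_sq_lt_sq _ (by positivity)
  have := l.four_mul_ae_pow
  have : 0 < l.α ^ 2 := by positivity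
  nlinarith

theorem Covector.k_sq {l : Covector} (h : l.α ≠ 0) :
    l.k ^ 2 = 1 / 2 + l.energy / (4 * l.ae ^ 2) := by
  refine sq_sqrt ?_
  have h1 := l.ae_pos h
  have h2 := (abs_lt.1 (l.abs_energy_lt h)).1
  rw [← sub_nonneg]
  have : 1 / 2 + l.energy / (4 * l.ae ^ 2) - 0
      = (2 * l.ae ^ 2 + l.energy) / (4 * l.ae ^ 2) := by field_simp; ring
  rw [this]
  exact div_nonneg (by linarith) (by positivity)

theorem Covector.energy_eq {l : Covector} (h : l.α ≠ 0) :
    l.energy = 2 * l.ae ^ 2 * (2 * l.k ^ 2 - 1) := by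
  have h1 := l.ae_pos h
  rw [l.k_sq h]; field_simp; ring

theorem Covector.k_sq_pos {l : Covector} (h : l.α ≠ 0) : 0 < l.k ^ 2 := by
  have h1 := (abs_lt.1 (l.abs_energy_lt h)).1
  rw [l.energy_eq h] at h1
  have := pow_pos (l.ae_pos h) 2
  nlinarith

theorem Covector.k_sq_lt_one {l : Covector} (h : l.α ≠ 0) : l.k ^ 2 < 1 := by
  have h1 := (abs_lt.1 (l.abs_energy_lt h)).2
  rw [l.energy_eq h] at h1
  have := pow_pos (l.ae_pos h) 2
  nlinarith

/-- Lets `16 æ⁴ k²` be factored out of `fy`, and makes the two formulas of `IsPhase` compatible with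
`cosh² - sinh² = 1`. -/
theorem Covector.α_sq {l : Covector} (h : l.α ≠ 0) :
    l.α ^ 2 = 16 * l.ae ^ 4 * l.k ^ 2 * (1 - l.k ^ 2) := by
  have := l.four_mul_ae_pow
  rw [l.energy_eq h] at this
  linear_combination -this

theorem fy_pos {l : Covector} (h : l.α ≠ 0) {p : ℝ} (hp : p ∈ Ioo 0 (ellipticK l.k)) :
    0 < fy l p := by
  have hk := l.k_sq_lt_one h
  have hk0 := l.k_sq_pos h
  have hkne : l.k ≠ 0 := by rintro h0; simp [h0] at hk0
  have hae := l.ae_pos h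
  have h1 := cn_pow_mul_lt_jacobiE hk hkne hp
  have hD := one_sub_sq_mul_one_sub_pow_pos hk (cn l.k p)
  rw [div_lt_iff₀ hD] at h1
  have : fy l p = 16 * l.ae ^ 4 * l.k ^ 2 * ((jacobiE l.k p - (1 - l.k ^ 2) * p) *
      (1 - l.k ^ 2 * (1 - cn l.k p ^ 4)) - l.k ^ 2 * (cn l.k p ^ 3 * sn l.k p * dn l.k p)) := by
    rw [fy, l.α_sq h, dn_sq hk, sn_sq]
    ring
  rw [this]
  have := sub_pos.2 h1
  positivity

/-! ### The phase, and existence of extremals before `t_sup` -/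

theorem exists_sn_mul_dn_div_cn_eq {k : ℝ} (hk : k ^ 2 < 1) (y : ℝ) :
    ∃ ψ ∈ Ioo (-ellipticK k) (ellipticK k), sn k ψ / cn k ψ * dn k ψ = y := by
  set r : ℝ → ℝ := fun u => tan u * √(1 - k ^ 2 * sin u ^ 2) with hr
  have hk' : 0 < √(1 - k ^ 2) := sqrt_pos.2 (by linarith)
  -- The square root in `r` is at least `√(1 - k²)`, so this amplitude already gives `r b ≥ |y|`;
  -- oddness of `r` brackets `y`.
  set b := arctan (|y| / √(1 - k ^ 2)) with hb
  have hb0 : 0 ≤ b := arctan_nonneg.2 (by positivity)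
  have hb1 : b < π / 2 := arctan_lt_pi_div_two _
  have hge : |y| ≤ r b := by
    have : √(1 - k ^ 2) ≤ √(1 - k ^ 2 * sin b ^ 2) :=
      sqrt_le_sqrt (by nlinarith [sq_nonneg k, sin_sq_le_one b])
    simp only [hr]
    rw [show tan b = |y| / √(1 - k ^ 2) from tan_arctan _, div_mul_eq_mul_div, le_div_iff₀ hk']
    exact mul_le_mul_of_nonneg_left this (abs_nonneg y)
  have hneg : r (-b) = -r b := by simp [hr]
  have hcont : ContinuousOn r (Icc (-b) b) := by
    refine ContinuousOn.mul ?_ (by fun_prop)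
    refine continuousOn_tan_Ioo.mono fun u hu => ⟨by linarith [hu.1], by linarith [hu.2]⟩
  have hy : y ∈ Icc (r (-b)) (r b) := by
    rw [hneg]
    exact ⟨by linarith [neg_abs_le y], (le_abs_self y).trans hge⟩
  obtain ⟨φ, hφ, hφy⟩ := intermediate_value_Icc (by linarith) hcont hy
  refine ⟨ellipticF k φ, ⟨?_, strictMono_ellipticF hk (by linarith [hφ.2])⟩, ?_⟩
  · rw [ellipticK, ← ellipticF_neg]
    exact strictMono_ellipticF hk (by linarith [hφ.1])
  · rw [← hφy]
    simp only [hr, sn, cn, dn, am_ellipticF hk, tan_eq_sin_div_cos]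

/-- The equation for `c` alone selects `ψ`. The energy integral then forces `sinh θ`, and `cosh θ`
is the positive root. -/
theorem exists_isPhase {l : Covector} (hα : 0 < l.α) : ∃ ψ, IsPhase l ψ := by
  have hk := l.k_sq_lt_one hα.ne'
  have hae := l.ae_pos hα.ne'
  obtain ⟨ψ, hψ, h⟩ := exists_sn_mul_dn_div_cn_eq hk (-l.c / (2 * l.ae))
  have hcn := cn_pos hk hψ
  have hc : l.c = -2 * l.ae * (sn l.k ψ / cn l.k ψ) * dn l.k ψ := by
    rw [mul_assoc, h]; field_simp
  have hsinh : sinh l.θ =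
      2 * l.ae ^ 2 * (1 - l.k ^ 2 * (1 + cn l.k ψ ^ 4)) / (l.α * cn l.k ψ ^ 2) := by
    have hE : l.α * sinh l.θ = l.c ^ 2 / 2 - l.energy := by unfold Covector.energy; ring
    rw [l.energy_eq hα.ne', hc] at hE
    rw [eq_div_iff (by positivity), show sinh l.θ * (l.α * cn l.k ψ ^ 2) =
      l.α * sinh l.θ * cn l.k ψ ^ 2 by ring, hE]
    have : (-2 * l.ae * (sn l.k ψ / cn l.k ψ) * dn l.k ψ) ^ 2 * cn l.k ψ ^ 2 =
        4 * l.ae ^ 2 * (1 - cn l.k ψ ^ 2) * (1 - l.k ^ 2 * (1 - cn l.k ψ ^ 2)) := by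
      rw [← sn_sq, ← dn_sq hk]; field_simp; ring
    linear_combination this / 2
  refine ⟨ψ, hψ, hc, hsinh, ?_⟩
  have hD := one_sub_sq_mul_one_sub_pow_pos hk (cn l.k ψ)
  have hsq : cosh l.θ ^ 2 =
      (2 * l.ae ^ 2 * (1 - l.k ^ 2 * (1 - cn l.k ψ ^ 4)) / (l.α * cn l.k ψ ^ 2)) ^ 2 := by
    rw [cosh_sq, hsinh]
    have := l.α_sq hα.ne'
    field_simp
    rw [this]
    ring
  exact (pow_left_inj₀ (cosh_pos _).le (by positivity) two_ne_zero).1 hsq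

/-- The vertical subsystem is solved by elliptic functions. -/
theorem exists_isVertical_of_isPhase {l : Covector} (hα : 0 < l.α) {ψ T : ℝ} (hψ : IsPhase l ψ)
    (hT : ψ + l.ae * T < ellipticK l.k) : ∃ θ c, IsVertical l T θ c := by
  have hk := l.k_sq_lt_one hα.ne'
  have hae := l.ae_pos hα.ne'
  set R : ℝ → ℝ := fun u => sn l.k u / cn l.k u * dn l.k u with hR
  set c : ℝ → ℝ := fun s => -2 * l.ae * R (ψ + l.ae * s) with hc
  -- The angle is recovered from `c` by the energy integral, solved for `sinh θ`.
  set θ : ℝ → ℝ := fun s => arsinh ((c s ^ 2 / 2 - l.energy) / l.α) with hθ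
  have hc0 : c 0 = l.c := by simp only [hc, hR, mul_zero, add_zero]; rw [hψ.c_eq]; ring
  have hmem : ∀ s ∈ Icc 0 T, ψ + l.ae * s ∈ Ioo (-ellipticK l.k) (ellipticK l.k) := by
    intro s hs
    have h1 := mul_nonneg hae.le hs.1
    have h2 := mul_le_mul_of_nonneg_left hs.2 hae.le
    exact ⟨by linarith [hψ.mem.1], by linarith⟩
  have hdc : ∀ s ∈ Icc 0 T, HasDerivAt c (-l.α * cosh (θ s)) s := by
    intro s hs
    set u := ψ + l.ae * s with hu
    have hcn : 0 < cn l.k u := cn_pos hk (hmem s hs)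
    have hRd := ((hasDerivAt_sn hk u).div (hasDerivAt_cn hk u) hcn.ne').mul (hasDerivAt_dn hk u)
    have hud : HasDerivAt (fun s => ψ + l.ae * s) l.ae s := by
      simpa using ((hasDerivAt_id s).const_mul l.ae).const_add ψ
    have hcd := (HasDerivAt.comp s hRd hud).const_mul (-2 * l.ae)
    refine hcd.congr_deriv ?_
    have hD := one_sub_sq_mul_one_sub_pow_pos hk (cn l.k u)
    have e1 := dn_sq hk u
    have e2 := sn_sq l.k u
    have hcosh : cosh (θ s) =
        2 * l.ae ^ 2 * (1 - l.k ^ 2 * (1 - cn l.k u ^ 4)) / (l.α * cn l.k u ^ 2) := by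
      refine (pow_left_inj₀ (cosh_pos _).le (by positivity) two_ne_zero).1 ?_
      have hcsq : c s ^ 2 = 4 * l.ae ^ 2 * (1 - cn l.k u ^ 2) *
          (1 - l.k ^ 2 * (1 - cn l.k u ^ 2)) / cn l.k u ^ 2 := by
        simp only [hc, hR, ← hu]
        rw [← e2, ← e1]; field_simp; ring
      have := l.α_sq hα.ne'
      rw [cosh_sq, sinh_arsinh, hcsq, l.energy_eq hα.ne']
      field_simp
      rw [this]
      ring
    rw [hcosh]
    simp only [Pi.div_apply]
    field_simp
    ring_nf
    simp only [e1, e2]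
    ring
  have hdθ : ∀ s ∈ Icc 0 T, HasDerivAt θ (-c s) s := by
    intro s hs
    have h := ((((hdc s hs).pow 2).div_const 2).sub_const l.energy).div_const l.α |>.arsinh
    refine h.congr_deriv ?_
    have : √(1 + ((c s ^ 2 / 2 - l.energy) / l.α) ^ 2) = cosh (θ s) := (cosh_arsinh _).symm
    simp only [Pi.pow_apply, this]
    have := cosh_pos (θ s)
    simp only [smul_eq_mul]
    field_simp
    norm_num
  refine ⟨θ, c, ?_, hc0, fun s hs => (hdθ s hs).hasDerivWithinAt,
    fun s hs => (hdc s hs).hasDerivWithinAt⟩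
  simp only [hθ, hc0]
  rw [show (l.c ^ 2 / 2 - l.energy) / l.α = sinh l.θ by
    unfold Covector.energy; field_simp; ring, arsinh_sinh]

theorem eps1_eps1 (l : Covector) : eps1 (eps1 l) = l := by simp [eps1]

theorem IsVertical.eps1 {l : Covector} {T : ℝ} {θ c : ℝ → ℝ} (h : IsVertical l T θ c) :
    IsVertical (eps1 l) T (fun s => -θ s) (fun s => -c s) where
  θ_zero := by simp [EngelTimelike.eps1, h.θ_zero]
  c_zero := by simp [EngelTimelike.eps1, h.c_zero]
  deriv_θ s hs := (h.deriv_θ s hs).neg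
  deriv_c s hs := by
    refine (h.deriv_c s hs).neg.congr_deriv ?_
    simp [EngelTimelike.eps1]

theorem exists_isVertical_of_lt_tSup {l : Covector} (hα : l.α ≠ 0) {T : ℝ}
    (hT : (T : EReal) < tSup l) : ∃ θ c, IsVertical l T θ c := by
  have hae := l.ae_pos hα
  rw [tSup, if_neg hα, EReal.coe_lt_coe_iff, lt_div_iff₀ hae] at hT
  rcases lt_or_gt_of_ne hα with hneg | hpos
  · have hpos : 0 < (eps1 l).α := neg_pos.2 hneg
    have hE : (eps1 l).energy = l.energy := by simp [Covector.energy, eps1]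
    have hae' : (eps1 l).ae = l.ae := by
      rw [Covector.ae, hE, Covector.ae]; simp [eps1]
    have hk' : (eps1 l).k = l.k := by simp [Covector.k, hE, hae']
    rw [Covector.ψ₀, if_neg hneg.not_gt] at hT
    -- The case `α < 0` is carried to `α > 0` by `ε¹`, which preserves `E`, `æ` and `k`. Any phase
    -- would serve, so the one picked by `epsilon` does.
    obtain ⟨θ, c, h⟩ := exists_isVertical_of_isPhase hpos (T := T)
      (Classical.epsilon_spec (exists_isPhase hpos)) (by rw [hae', hk']; linarith)
    have := h.eps1
    rw [eps1_eps1] at this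
    exact ⟨_, _, this⟩
  · rw [Covector.ψ₀, if_pos hpos] at hT
    exact exists_isVertical_of_isPhase hpos
      (Classical.epsilon_spec (exists_isPhase hpos)) (by linarith)

/-- A trajectory of the vertical subsystem lifts to an extremal. -/
theorem IsVertical.exists_isExtremal {l : Covector} {T : ℝ} (hT : 0 ≤ T) {θ c : ℝ → ℝ}
    (h : IsVertical l T θ c) : ∃ q, IsExtremal l T θ c q := by
  -- Extending `θ` by constants makes all integrands continuous on the line. The system for `q` is
  -- triangular, so `x₁`, `x₂`, then `y`, `z` are plain integrals.
  set η : ℝ → ℝ := IccExtend hT (fun s => θ s) with hη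
  have hηc : Continuous η := by
    refine Continuous.Icc_extend' ?_
    exact continuousOn_iff_continuous_domRestrict.1 fun s hs => (h.deriv_θ s hs).continuousWithinAt
  have hηθ : ∀ s ∈ Icc 0 T, η s = θ s := fun s hs => IccExtend_of_mem hT _ hs
  have key : ∀ {f : ℝ → ℝ}, Continuous f →
      ∀ s, HasDerivAt (fun s => ∫ r in (0 : ℝ)..s, f r) (f s) s :=
    fun hf s => (hf.integral_hasStrictDerivAt 0 s).hasDerivAt
  have hcont : ∀ {F f : ℝ → ℝ}, (∀ s, HasDerivAt F (f s) s) → Continuous F :=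
    fun hF => continuous_iff_continuousAt.2 fun s => (hF s).continuousAt
  have h1 := key (f := fun r => -cosh (η r)) (by fun_prop)
  set x1 : ℝ → ℝ := fun s => ∫ r in (0 : ℝ)..s, -cosh (η r)
  have h2 := key (f := fun r => sinh (η r)) (by fun_prop)
  set x2 : ℝ → ℝ := fun s => ∫ r in (0 : ℝ)..s, sinh (η r)
  have c1 : Continuous x1 := hcont h1
  have c2 : Continuous x2 := hcont h2
  have h3 := key (f := fun r => -cosh (η r) * -(x2 r / 2) + sinh (η r) * (x1 r / 2))
    (by fun_prop)
  have h4 := key (f := fun r => sinh (η r) * ((x1 r ^ 2 + x2 r ^ 2) / 2)) (by fun_prop)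
  set y : ℝ → ℝ := fun s => ∫ r in (0 : ℝ)..s,
    -cosh (η r) * -(x2 r / 2) + sinh (η r) * (x1 r / 2)
  set z : ℝ → ℝ := fun s => ∫ r in (0 : ℝ)..s, sinh (η r) * ((x1 r ^ 2 + x2 r ^ 2) / 2)
  refine ⟨fun s => ![x1 s, x2 s, y s, z s], h, ?_, fun s hs => hasDerivWithinAt_pi.2 fun i => ?_⟩
  · ext i
    fin_cases i <;> simp [x1, x2, y, z]
  · rw [← hηθ s hs]
    fin_cases i
    · simpa [X₁, X₂] using (h1 s).hasDerivWithinAt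
    · simpa [X₁, X₂] using (h2 s).hasDerivWithinAt
    · simpa [X₁, X₂] using (h3 s).hasDerivWithinAt
    · simpa [X₁, X₂] using (h4 s).hasDerivWithinAt

/-! ### Uniqueness and comparison of solutions -/

theorem eq_of_hasDerivWithinAt_eq {f g f' : ℝ → ℝ} {T : ℝ}
    (hf : ∀ s ∈ Icc 0 T, HasDerivWithinAt f (f' s) (Icc 0 T) s)
    (hg : ∀ s ∈ Icc 0 T, HasDerivWithinAt g (f' s) (Icc 0 T) s) (h0 : f 0 = g 0) :
    ∀ s ∈ Icc 0 T, f s = g s := by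
  intro s hs
  have hd : ∀ s ∈ Icc 0 T, HasDerivWithinAt (f - g) 0 (Icc 0 T) s := fun s hs => by
    simpa using (hf s hs).sub (hg s hs)
  have h := constant_of_derivWithin_zero (fun s hs => (hd s hs).differentiableWithinAt)
    (fun s hs => (hd s (Ico_subset_Icc_self hs)).derivWithin
      (uniqueDiffOn_Icc (hs.1.trans_lt hs.2) s (Ico_subset_Icc_self hs))) s hs
  simp only [Pi.sub_apply, h0, sub_self] at h
  linarith

theorem IsVertical.energy_eq {l : Covector} {T : ℝ} {θ c : ℝ → ℝ} (h : IsVertical l T θ c) :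
    ∀ s ∈ Icc 0 T, c s ^ 2 / 2 - l.α * sinh (θ s) = l.energy := by
  refine eq_of_hasDerivWithinAt_eq (f' := fun _ => 0) (fun s hs => ?_)
    (fun s _ => hasDerivWithinAt_const _ _ _) (by rw [h.c_zero, h.θ_zero]; rfl)
  refine ((((h.deriv_c s hs).pow 2).div_const 2).sub
    ((h.deriv_θ s hs).sinh.const_mul l.α)).congr_deriv ?_
  ring

theorem cosh_sub_cosh_mul_cosh (a b : ℝ) :
    (cosh a - cosh b) * cosh ((a + b) / 2) = (sinh a - sinh b) * sinh ((a + b) / 2) := by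
  obtain ⟨m, d, rfl, rfl⟩ : ∃ m d : ℝ, a = m + d ∧ b = m - d :=
    ⟨(a + b) / 2, (a - b) / 2, by ring, by ring⟩
  rw [show (m + d + (m - d)) / 2 = m by ring]
  simp only [cosh_add, cosh_sub, sinh_add, sinh_sub]
  ring

/-- Two solutions on the same energy level: the difference of the velocities `c` is proportional
to `cosh` of the mean of the angles `θ`. -/
theorem IsVertical.sub_div_cosh_eq {l l' : Covector} {T : ℝ} {θ c θ' c' : ℝ → ℝ}
    (h : IsVertical l T θ c) (h' : IsVertical l' T θ' c') (hα : l'.α = l.α)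
    (hE : l'.energy = l.energy) :
    ∀ s ∈ Icc 0 T, (c s - c' s) / cosh ((θ s + θ' s) / 2) =
      (l.c - l'.c) / cosh ((l.θ + l'.θ) / 2) := by
  refine eq_of_hasDerivWithinAt_eq (f' := fun _ => 0) (fun s hs => ?_)
    (fun s _ => hasDerivWithinAt_const _ _ _) (by rw [h.c_zero, h.θ_zero, h'.c_zero, h'.θ_zero])
  refine (((h.deriv_c s hs).sub (h'.deriv_c s hs)).div
    (((h.deriv_θ s hs).add (h'.deriv_θ s hs)).div_const 2).cosh (cosh_pos _).ne').congr_deriv ?_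
  rw [div_eq_zero_iff]
  left
  have e1 := h.energy_eq s hs
  have e2 := h'.energy_eq s hs
  rw [hα, hE] at e2
  have e3 := cosh_sub_cosh_mul_cosh (θ s) (θ' s)
  simp only [Pi.add_apply, Pi.sub_apply, hα]
  -- Equal energies turn `(c² - c'²) / 2` into `α (sinh θ - sinh θ')`, and the identity `e3` cancels
  -- the rest.
  linear_combination sinh ((θ s + θ' s) / 2) * (e1 - e2) - l.α * e3

/-- Equal initial covectors make the constant ratio `(c - c') / cosh` zero, so no Lipschitz estimate
is needed. -/
theorem IsVertical.unique {l : Covector} {T : ℝ} {θ c θ' c' : ℝ → ℝ}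
    (h : IsVertical l T θ c) (h' : IsVertical l T θ' c') :
    ∀ s ∈ Icc 0 T, θ s = θ' s ∧ c s = c' s := by
  have hc : ∀ s ∈ Icc 0 T, c s = c' s := fun s hs => by
    have := h.sub_div_cosh_eq h' rfl rfl s hs
    rw [sub_self, zero_div, div_eq_zero_iff] at this
    exact sub_eq_zero.1 (this.resolve_right (cosh_pos _).ne')
  refine fun s hs => ⟨?_, hc s hs⟩
  exact eq_of_hasDerivWithinAt_eq h.deriv_θ (fun s hs => by rw [hc s hs]; exact h'.deriv_θ s hs)
    (by rw [h.θ_zero, h'.θ_zero]) s hs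

section Components

variable {l : Covector} {T : ℝ} {θ c : ℝ → ℝ} {q : ℝ → Fin 4 → ℝ}

theorem IsExtremal.deriv_x₁ (h : IsExtremal l T θ c q) :
    ∀ s ∈ Icc 0 T, HasDerivWithinAt (fun s => q s 0) (-cosh (θ s)) (Icc 0 T) s := fun s hs => by
  simpa [X₁, X₂] using hasDerivWithinAt_pi.1 (h.deriv_q s hs) 0

theorem IsExtremal.deriv_x₂ (h : IsExtremal l T θ c q) :
    ∀ s ∈ Icc 0 T, HasDerivWithinAt (fun s => q s 1) (sinh (θ s)) (Icc 0 T) s := fun s hs => by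
  simpa [X₁, X₂] using hasDerivWithinAt_pi.1 (h.deriv_q s hs) 1

theorem IsExtremal.deriv_y (h : IsExtremal l T θ c q) :
    ∀ s ∈ Icc 0 T, HasDerivWithinAt (fun s => q s 2)
      ((cosh (θ s) * q s 1 + sinh (θ s) * q s 0) / 2) (Icc 0 T) s := fun s hs => by
  refine (hasDerivWithinAt_pi.1 (h.deriv_q s hs) 2).congr_deriv ?_
  simp [X₁, X₂]
  ring

theorem IsExtremal.deriv_z (h : IsExtremal l T θ c q) :
    ∀ s ∈ Icc 0 T, HasDerivWithinAt (fun s => q s 3)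
      (sinh (θ s) * ((q s 0 ^ 2 + q s 1 ^ 2) / 2)) (Icc 0 T) s := fun s hs => by
  simpa [X₁, X₂] using hasDerivWithinAt_pi.1 (h.deriv_q s hs) 3

/-- An extremal from its coordinate equations. -/
theorem IsVertical.isExtremal (h : IsVertical l T θ c) (h0 : q 0 = 0)
    (h1 : ∀ s ∈ Icc 0 T, HasDerivWithinAt (fun s => q s 0) (-cosh (θ s)) (Icc 0 T) s)
    (h2 : ∀ s ∈ Icc 0 T, HasDerivWithinAt (fun s => q s 1) (sinh (θ s)) (Icc 0 T) s)
    (h3 : ∀ s ∈ Icc 0 T, HasDerivWithinAt (fun s => q s 2)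
      ((cosh (θ s) * q s 1 + sinh (θ s) * q s 0) / 2) (Icc 0 T) s)
    (h4 : ∀ s ∈ Icc 0 T, HasDerivWithinAt (fun s => q s 3)
      (sinh (θ s) * ((q s 0 ^ 2 + q s 1 ^ 2) / 2)) (Icc 0 T) s) : IsExtremal l T θ c q := by
  refine ⟨h, h0, fun s hs => hasDerivWithinAt_pi.2 fun i => ?_⟩
  fin_cases i
  · simpa [X₁, X₂] using h1 s hs
  · simpa [X₁, X₂] using h2 s hs
  · refine (h3 s hs).congr_deriv ?_
    simp [X₁, X₂]
    ring
  · simpa [X₁, X₂] using h4 s hs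

theorem IsExtremal.unique {θ' c' : ℝ → ℝ} {q' : ℝ → Fin 4 → ℝ} (h : IsExtremal l T θ c q)
    (h' : IsExtremal l T θ' c' q') : ∀ s ∈ Icc 0 T, q s = q' s := by
  have hθ : ∀ s ∈ Icc 0 T, θ' s = θ s := fun s hs => (h'.toIsVertical.unique h.toIsVertical s hs).1
  have hz : ∀ i, q 0 i = q' 0 i := fun i => by rw [h.q_zero, h'.q_zero]
  have e1 := eq_of_hasDerivWithinAt_eq h.deriv_x₁
    (fun s hs => by rw [← hθ s hs]; exact h'.deriv_x₁ s hs) (hz 0)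
  have e2 := eq_of_hasDerivWithinAt_eq h.deriv_x₂
    (fun s hs => by rw [← hθ s hs]; exact h'.deriv_x₂ s hs) (hz 1)
  have e3 := eq_of_hasDerivWithinAt_eq h.deriv_y
    (fun s hs => by rw [e1 s hs, e2 s hs, ← hθ s hs]; exact h'.deriv_y s hs) (hz 2)
  have e4 := eq_of_hasDerivWithinAt_eq h.deriv_z
    (fun s hs => by rw [e1 s hs, e2 s hs, ← hθ s hs]; exact h'.deriv_z s hs) (hz 3)
  intro s hs
  ext i
  fin_cases i
  · exact e1 s hs
  · exact e2 s hs
  · exact e3 s hs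
  · exact e4 s hs

theorem IsExtremal.exp_eq (hT : 0 ≤ T) (h : IsExtremal l T θ c q) : Exp l T = q T := by
  obtain ⟨θ', c', q', h', hq⟩ := Classical.epsilon_spec
    (p := fun p => ∃ θ c q, IsExtremal l T θ c q ∧ p = q T) ⟨q T, θ, c, q, h, rfl⟩
  exact hq.trans (h'.unique h T (right_mem_Icc.2 hT))

theorem IsVertical.verticalFlow_eq (hT : 0 ≤ T) (h : IsVertical l T θ c) :
    verticalFlow l T = ⟨θ T, c T, l.α⟩ := by
  obtain ⟨θ', c', h', hm⟩ := Classical.epsilon_spec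
    (p := fun m : Covector => ∃ θ c, IsVertical l T θ c ∧ m = ⟨θ T, c T, l.α⟩) ⟨⟨θ T, c T, l.α⟩, θ, c, h, rfl⟩
  have := h'.unique h T (right_mem_Icc.2 hT)
  rw [verticalFlow, hm, this.1, this.2]

/-! ### Symmetries of extremals -/

theorem hasDerivWithinAt_comp_sub {f : ℝ → ℝ} {f' a s : ℝ} (ha : a ∈ Icc 0 T)
    (hf : HasDerivWithinAt f f' (Icc 0 T) (a - s)) :
    HasDerivWithinAt (fun s => f (a - s)) (-f') (Icc 0 a) s := by
  have h1 : HasDerivWithinAt (fun s => a - s) (-1) (Icc 0 a) s :=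
    ((hasDerivAt_id s).const_sub a).hasDerivWithinAt
  have := hf.comp s h1 fun r hr => ⟨by linarith [hr.2], by linarith [hr.1, ha.2]⟩
  exact this.congr_deriv (by ring)

theorem hasDerivWithinAt_comp_add {f : ℝ → ℝ} {f' a s : ℝ} (ha : a ∈ Icc 0 T)
    (hf : HasDerivWithinAt f f' (Icc 0 T) (a + s)) :
    HasDerivWithinAt (fun s => f (a + s)) f' (Icc 0 (T - a)) s := by
  have h1 : HasDerivWithinAt (fun s => a + s) 1 (Icc 0 (T - a)) s :=
    ((hasDerivAt_id s).const_add a).hasDerivWithinAt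
  have := hf.comp s h1 fun r hr => ⟨by linarith [hr.1, ha.1], by linarith [hr.2]⟩
  exact this.congr_deriv (by ring)

/-- Time reversal of a solution. -/
theorem IsVertical.reverse (h : IsVertical l T θ c) {a : ℝ} (ha : a ∈ Icc 0 T) :
    IsVertical ⟨θ a, -c a, l.α⟩ a (fun s => θ (a - s)) (fun s => -c (a - s)) where
  θ_zero := by simp
  c_zero := by simp
  deriv_θ s hs := (hasDerivWithinAt_comp_sub ha
    (h.deriv_θ _ ⟨by linarith [hs.2], by linarith [hs.1, ha.2]⟩)).congr_deriv (by ring)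
  deriv_c s hs := (hasDerivWithinAt_comp_sub ha
    (h.deriv_c _ ⟨by linarith [hs.2], by linarith [hs.1, ha.2]⟩)).neg.congr_deriv (by ring)

/-- Time translation of a solution. -/
theorem IsVertical.translate (h : IsVertical l T θ c) {a : ℝ} (ha : a ∈ Icc 0 T) :
    IsVertical ⟨θ a, c a, l.α⟩ (T - a) (fun s => θ (a + s)) (fun s => c (a + s)) where
  θ_zero := by simp
  c_zero := by simp
  deriv_θ s hs := hasDerivWithinAt_comp_add ha
    (h.deriv_θ _ ⟨by linarith [hs.1, ha.1], by linarith [hs.2]⟩)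
  deriv_c s hs := hasDerivWithinAt_comp_add ha
    (h.deriv_c _ ⟨by linarith [hs.1, ha.1], by linarith [hs.2]⟩)

/-- The map `(x₁, x₂, y, z) ↦ (x₁, -x₂, -y, -z)` preserves `X₁` and reverses `X₂`. -/
theorem IsExtremal.eps1 (h : IsExtremal l T θ c q) :
    IsExtremal (eps1 l) T (fun s => -θ s) (fun s => -c s)
      (fun s => ![q s 0, -q s 1, -q s 2, -q s 3]) := by
  refine h.toIsVertical.eps1.isExtremal ?_ (fun s hs => ?_) (fun s hs => ?_) (fun s hs => ?_)
    (fun s hs => ?_)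
  · ext i; fin_cases i <;> simp [h.q_zero]
  · simpa using h.deriv_x₁ s hs
  · simp only [sinh_neg]
    exact (h.deriv_x₂ s hs).neg
  · refine (h.deriv_y s hs).neg.congr_deriv ?_
    simp
    ring
  · refine (h.deriv_z s hs).neg.congr_deriv ?_
    simp

theorem IsExtremal.reverse (hT : 0 ≤ T) (h : IsExtremal l T θ c q) :
    ∃ q', IsExtremal ⟨θ T, -c T, l.α⟩ T (fun s => θ (T - s)) (fun s => -c (T - s)) q' ∧
      q' T = ![q T 0, q T 1, -q T 2, q T 3 - q T 0 * q T 2] := by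
  have hTm : T ∈ Icc 0 T := right_mem_Icc.2 hT
  set a := q T
  -- The curve `q (T - s)` is left-translated by the inverse of `q T`, then mapped by `(x₁, x₂, y,
  -- z) ↦ (-x₁, -x₂, y, -z)`, which reverses both `X₁` and `X₂` and so restores the velocity.
  refine ⟨fun s => ![a 0 - q (T - s) 0, a 1 - q (T - s) 1,
    (a 1 * q (T - s) 0 - a 0 * q (T - s) 1) / 2 - a 2 + q (T - s) 2,
    a 3 - q (T - s) 3 + (a 0 ^ 2 + a 1 ^ 2) / 2 * (a 1 - q (T - s) 1)
      - a 0 * (a 2 - q (T - s) 2 + (a 0 * a 1 - q (T - s) 0 * q (T - s) 1) / 2)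
      - a 1 * ((a 1 ^ 2 - q (T - s) 1 ^ 2) / 2)], ?_, ?_⟩
  · have hm : ∀ s ∈ Icc 0 T, T - s ∈ Icc 0 T := fun s hs =>
      ⟨by linarith [hs.2], by linarith [hs.1]⟩
    have h1 := fun s hs => hasDerivWithinAt_comp_sub hTm (h.deriv_x₁ (T - s) (hm s hs))
    have h2 := fun s hs => hasDerivWithinAt_comp_sub hTm (h.deriv_x₂ (T - s) (hm s hs))
    have h3 := fun s hs => hasDerivWithinAt_comp_sub hTm (h.deriv_y (T - s) (hm s hs))
    have h4 := fun s hs => hasDerivWithinAt_comp_sub hTm (h.deriv_z (T - s) (hm s hs))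
    refine (h.toIsVertical.reverse hTm).isExtremal ?_ (fun s hs => ?_) (fun s hs => ?_)
      (fun s hs => ?_) (fun s hs => ?_)
    · ext i
      fin_cases i <;> simp [a]
      ring
    · refine ((h1 s hs).const_sub (a 0)).congr_deriv ?_
      simp
    · refine ((h2 s hs).const_sub (a 1)).congr_deriv ?_
      simp
    · refine (((((h1 s hs).const_mul (a 1)).sub ((h2 s hs).const_mul (a 0))).div_const 2).sub_const
        (a 2) |>.add (h3 s hs)).congr_deriv ?_
      simp
      ring
    · refine ((((h4 s hs).const_sub (a 3)).add
        (((h2 s hs).const_sub (a 1)).const_mul ((a 0 ^ 2 + a 1 ^ 2) / 2))).sub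
        ((((h3 s hs).const_sub (a 2)).add
          ((((h1 s hs).mul (h2 s hs)).const_sub (a 0 * a 1)).div_const 2)).const_mul (a 0)) |>.sub
        (((((h2 s hs).pow 2).const_sub (a 1 ^ 2)).div_const 2).const_mul (a 1))).congr_deriv ?_
      simp
      ring
  · ext i
    fin_cases i <;> simp [a, h.q_zero]
    ring

end Components

/-! ### Arcs with vanishing coordinate `y` -/

theorem strictAntiOn_of_hasDerivWithinAt_Icc {f f' : ℝ → ℝ} {a b : ℝ}
    (hf : ∀ s ∈ Icc a b, HasDerivWithinAt f (f' s) (Icc a b) s)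
    (hn : ∀ s ∈ Ioo a b, f' s < 0) : StrictAntiOn f (Icc a b) := by
  refine strictAntiOn_of_hasDerivWithinAt_neg (convex_Icc a b)
    (fun s hs => (hf s hs).continuousWithinAt)
    (fun s hs => (hf s (interior_subset hs)).mono interior_subset) ?_
  rwa [interior_Icc]

section

variable {l : Covector} {m : ℝ} {θ c : ℝ → ℝ} {q : ℝ → Fin 4 → ℝ}

/-- If `c` vanishes at the midpoint, the arc is symmetric under time reversal. -/
theorem IsVertical.symm_of_mid_eq_zero (hm : 0 ≤ m) (h : IsVertical l (2 * m) θ c)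
    (hc : c m = 0) : θ (2 * m) = l.θ ∧ c (2 * m) = -l.c := by
  have hmem : m ∈ Icc 0 (2 * m) := ⟨hm, by linarith⟩
  have h1 := h.translate hmem
  have h2 := h.reverse hmem
  rw [hc, show 2 * m - m = m by ring] at h1
  rw [hc, neg_zero] at h2
  have := h1.unique h2 m (right_mem_Icc.2 hm)
  simp only [← two_mul, sub_self, h.θ_zero, h.c_zero] at this
  exact this

/-- If `c` does not vanish at the midpoint, `y` does not vanish at the endpoint. -/
theorem IsExtremal.y_ne_zero (hm : 0 < m) (h : IsExtremal l (2 * m) θ c q) (hc : c m ≠ 0) :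
    q (2 * m) 2 ≠ 0 := by
  have hmem : m ∈ Icc 0 (2 * m) := ⟨hm.le, by linarith⟩
  have h1 := h.toIsVertical.translate hmem
  have h2 := h.toIsVertical.reverse hmem
  rw [show 2 * m - m = m by ring] at h1
  -- The arc leaving the midpoint forwards is compared with the one leaving it backwards; `c (m + s)
  -- + c (m - s)` thus has the sign of `c m`.
  have hcosh := h1.sub_div_cosh_eq h2 rfl (by simp [Covector.energy])
  simp only [add_self_div_two, sub_neg_eq_add] at hcosh
  have hp : ∀ s ∈ Icc 0 m, m + s ∈ Icc 0 (2 * m) := fun s hs =>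
    ⟨by linarith [hs.1], by linarith [hs.2]⟩
  have hn : ∀ s ∈ Icc 0 m, m - s ∈ Icc 0 (2 * m) := fun s hs =>
    ⟨by linarith [hs.2], by linarith [hs.1]⟩
  have shift : ∀ {f f' : ℝ → ℝ}, (∀ s ∈ Icc 0 (2 * m),
      HasDerivWithinAt f (f' s) (Icc 0 (2 * m)) s) → ∀ s ∈ Icc 0 m,
      HasDerivWithinAt (fun s => f (m + s)) (f' (m + s)) (Icc 0 m) s := fun hf s hs => by
    have := hasDerivWithinAt_comp_add hmem (hf _ (hp s hs))
    rwa [show 2 * m - m = m by ring] at this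
  have flip : ∀ {f f' : ℝ → ℝ}, (∀ s ∈ Icc 0 (2 * m),
      HasDerivWithinAt f (f' s) (Icc 0 (2 * m)) s) → ∀ s ∈ Icc 0 m,
      HasDerivWithinAt (fun s => f (m - s)) (-f' (m - s)) (Icc 0 m) s := fun hf s hs =>
    hasDerivWithinAt_comp_sub hmem (hf _ (hn s hs))
  have h0 : (0 : ℝ) ∈ Icc 0 m := left_mem_Icc.2 hm.le
  -- the difference of the angles at symmetric times has a constant sign
  have hdiff : ∀ s ∈ Ioo 0 m, c m * (θ (m + s) - θ (m - s)) < 0 := by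
    have := strictAntiOn_of_hasDerivWithinAt_Icc (fun s hs =>
      ((shift h.deriv_θ s hs).sub (flip h.deriv_θ s hs)).const_mul (c m)) (fun s hs => by
        have e := hcosh s (Ioo_subset_Icc_self hs)
        rw [div_eq_iff (cosh_pos _).ne'] at e
        rw [show c m * (-c (m + s) - -(-c (m - s))) = -(c m * (c (m + s) + c (m - s))) by ring, e]
        have e1 := cosh_pos (θ m)
        have e2 := cosh_pos ((θ (m + s) + θ (m - s)) / 2)
        rw [show c m * ((c m + c m) / cosh (θ m) * cosh ((θ (m + s) + θ (m - s)) / 2)) =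
          2 * c m ^ 2 / cosh (θ m) * cosh ((θ (m + s) + θ (m - s)) / 2) by ring]
        rw [neg_lt_zero]
        positivity)
    intro s hs
    simpa using this h0 (Ioo_subset_Icc_self hs) hs.1
  -- the chord between symmetric times is timelike
  have hsum : ∀ s ∈ Ioo 0 m, (q (m + s) 0 - q (m - s) 0) + (q (m + s) 1 - q (m - s) 1) < 0 := by
    have := strictAntiOn_of_hasDerivWithinAt_Icc (fun s hs =>
      ((shift h.deriv_x₁ s hs).sub (flip h.deriv_x₁ s hs)).add
        ((shift h.deriv_x₂ s hs).sub (flip h.deriv_x₂ s hs))) (fun s _ => by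
        linarith [sinh_lt_cosh (θ (m + s)), sinh_lt_cosh (θ (m - s))])
    intro s hs
    simpa using this h0 (Ioo_subset_Icc_self hs) hs.1
  have hsub : ∀ s ∈ Ioo 0 m, (q (m + s) 0 - q (m - s) 0) - (q (m + s) 1 - q (m - s) 1) < 0 := by
    have := strictAntiOn_of_hasDerivWithinAt_Icc (fun s hs =>
      ((shift h.deriv_x₁ s hs).sub (flip h.deriv_x₁ s hs)).sub
        ((shift h.deriv_x₂ s hs).sub (flip h.deriv_x₂ s hs))) (fun s _ => by
        have e1 := sinh_lt_cosh (-θ (m + s))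
        have e2 := sinh_lt_cosh (-θ (m - s))
        rw [sinh_neg, cosh_neg] at e1 e2
        linarith)
    intro s hs
    simpa using this h0 (Ioo_subset_Icc_self hs) hs.1
  -- the coordinate `y` of the arc between symmetric times, translated to the identity
  have hY := strictAntiOn_of_hasDerivWithinAt_Icc (fun s hs =>
      (((shift h.deriv_y s hs).sub (flip h.deriv_y s hs)).sub
      ((((flip h.deriv_x₁ s hs).mul (shift h.deriv_x₂ s hs)).sub
        ((flip h.deriv_x₂ s hs).mul (shift h.deriv_x₁ s hs))).div_const 2)).const_mul (-c m))
      (fun s hs => by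
        have e0 := hdiff s hs
        have e1 := hsum s hs
        have e2 := hsub s hs
        -- With mean `M` and half-difference `d` of the angles, the derivative factors as `-c m *
        -- sinh d` times `cosh M * x + sinh M * y`. The latter is negative because the chord is
        -- timelike.
        obtain ⟨M, d, eM, ed⟩ : ∃ M d : ℝ, θ (m + s) = M + d ∧ θ (m - s) = M - d :=
          ⟨(θ (m + s) + θ (m - s)) / 2, (θ (m + s) - θ (m - s)) / 2, by ring, by ring⟩
        rw [eM, ed] at e0 ⊢
        have e3 : 0 < (-c m) * sinh d := by
          rcases lt_or_gt_of_ne hc with hneg | hpos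
          · have : 0 < d := by nlinarith
            exact mul_pos (by linarith) (sinh_pos_iff.2 this)
          · have : d < 0 := by nlinarith
            exact mul_pos_of_neg_of_neg (by linarith) (sinh_neg_iff.2 this)
        set x := q (m + s) 0 - q (m - s) 0 with hx
        set y := q (m + s) 1 - q (m - s) 1 with hy
        have e4 : cosh M * x + sinh M * y < 0 := by
          have hM1 := sinh_lt_cosh M
          have hM2 := sinh_lt_cosh (-M)
          rw [sinh_neg, cosh_neg] at hM2
          nlinarith [mul_pos_of_neg_of_neg e1 (show -(cosh M + sinh M) < 0 by linarith),
            mul_pos_of_neg_of_neg e2 (show -(cosh M - sinh M) < 0 by linarith)]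
        refine lt_of_eq_of_lt ?_ (mul_neg_of_pos_of_neg e3 e4)
        simp only [cosh_add, cosh_sub, sinh_add, sinh_sub, hx, hy]
        ring)
  -- At `s = 0` the arc is a point; at `s = m` it is the whole arc from the identity, with
  -- coordinate `y (2m)`.
  have := hY h0 (right_mem_Icc.2 hm.le) hm
  simp only [add_zero, sub_zero, sub_self, ← two_mul, h.q_zero, Pi.zero_apply, Pi.sub_apply,
    Pi.mul_apply] at this
  intro hy
  rw [hy] at this
  refine absurd this (le_of_eq ?_).not_gt
  ring

end

/-! ### Arcs with vanishing coordinate `x₂` -/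

/-- The function `x ↦ x / √(α² + x²)` is odd and strictly increasing. -/
theorem div_sqrt_add_div_sqrt_mul_pos {α x y : ℝ} (hα : α ≠ 0) (hxy : x + y ≠ 0) :
    0 < (x / √(α ^ 2 + x ^ 2) + y / √(α ^ 2 + y ^ 2)) * (x + y) := by
  have hα2 : 0 < α ^ 2 := by positivity
  have hr : 0 < √(α ^ 2 + x ^ 2) := sqrt_pos.2 (by positivity)
  have hs : 0 < √(α ^ 2 + y ^ 2) := sqrt_pos.2 (by positivity)
  have hr2 : √(α ^ 2 + x ^ 2) ^ 2 = α ^ 2 + x ^ 2 := sq_sqrt (by positivity)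
  have hs2 : √(α ^ 2 + y ^ 2) ^ 2 = α ^ 2 + y ^ 2 := sq_sqrt (by positivity)
  set r := √(α ^ 2 + x ^ 2)
  set s := √(α ^ 2 + y ^ 2)
  have hrx : |x| < r := abs_lt_of_sq_lt_sq (by linarith) hr.le
  have hsy : |y| < s := abs_lt_of_sq_lt_sq (by linarith) hs.le
  have hlt : 0 < (r + s) ^ 2 - (x - y) ^ 2 := by
    have h1 : |x - y| < r + s := (abs_sub x y).trans_lt (by linarith)
    linarith [sq_lt_sq' (by linarith [neg_abs_le (x - y)]) ((le_abs_self (x - y)).trans_lt h1)]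
  have hid : (x / r + y / s) * (x + y) =
      (x + y) ^ 2 * ((r + s) ^ 2 - (x - y) ^ 2) / (2 * (r * s * (r + s))) := by
    field_simp
    linear_combination (x - y) * (hs2 - hr2)
  rw [hid]
  positivity

/-- For the even function `g(v) = P / √(α² + P²)`, `P = v² / 2 - E`: if the mean of `g` over an
interval vanishes, then its moment against `(v - a)(v - b)` does not. -/
theorem integral_mul_ne_zero {α E a b : ℝ} (hα : α ≠ 0) (hab : a ≠ b)
    (h : ∫ v in a..b, (v ^ 2 / 2 - E) / √(α ^ 2 + (v ^ 2 / 2 - E) ^ 2) = 0) :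
    ∫ v in a..b, (v ^ 2 / 2 - E) / √(α ^ 2 + (v ^ 2 / 2 - E) ^ 2) * ((v - a) * (v - b)) ≠ 0 := by
  wlog hlt : a < b generalizing a b
  · have h1 : b < a := lt_of_le_of_ne (not_lt.1 hlt) hab.symm
    have h2 := this hab.symm (by rw [intervalIntegral.integral_symm, h, neg_zero]) h1
    rw [intervalIntegral.integral_symm, neg_ne_zero]
    simpa only [mul_comm (_ - b) (_ - a)] using h2
  set P : ℝ → ℝ := fun v => v ^ 2 / 2 - E with hP
  set g : ℝ → ℝ := fun v => P v / √(α ^ 2 + P v ^ 2) with hg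
  change ∫ v in a..b, g v = 0 at h
  change ∫ v in a..b, g v * ((v - a) * (v - b)) ≠ 0
  have hPc : Continuous P := by fun_prop
  have hgc : Continuous g := hPc.div (by fun_prop) fun v => (sqrt_pos.2 (by positivity)).ne'
  -- `Q` is invariant under `v ↦ a + b - v` and differs from `(v - a)(v - b)` by a constant, which
  -- the zero mean of `g` kills.
  set Q : ℝ → ℝ := fun v => P v + P (a + b - v) with hQ
  obtain ⟨C, hC⟩ : ∃ C : ℝ, ∀ v, Q v = (v - a) * (v - b) + C :=
    ⟨(a + b) ^ 2 / 2 - a * b - 2 * E, fun v => by simp only [hQ, hP]; ring⟩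
  have hii : ∀ {f : ℝ → ℝ}, Continuous f → IntervalIntegrable f MeasureTheory.volume a b :=
    fun hf => hf.intervalIntegrable a b
  have hrefl : ∀ f : ℝ → ℝ, ∫ v in a..b, f (a + b - v) = ∫ v in a..b, f v := fun f => by
    rw [intervalIntegral.integral_comp_sub_left, add_sub_cancel_right, add_sub_cancel_left]
  have hpos : 0 < ∫ v in a..b, (g v + g (a + b - v)) * Q v := by
    have hnn : ∀ v, Q v ≠ 0 → 0 < (g v + g (a + b - v)) * Q v := fun v hv =>
      div_sqrt_add_div_sqrt_mul_pos hα hv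
    refine intervalIntegral.integral_pos hlt (by fun_prop) (fun v _ => ?_) ?_
    · by_cases hv : Q v = 0
      · rw [hv, mul_zero]
      · exact (hnn v hv).le
    · by_cases hv : Q a = 0
      -- If `Q a = 0` then `C = 0`, and `Q` equals `-(b - a)² / 4` at the midpoint.
      · refine ⟨(a + b) / 2, ⟨by linarith, by linarith⟩, hnn _ ?_⟩
        rw [hC] at hv ⊢
        have : 0 < (b - a) ^ 2 := pow_pos (sub_pos.2 hlt) 2
        nlinarith
      · exact ⟨a, left_mem_Icc.2 hlt.le, hnn a hv⟩
  have hsplit : ∫ v in a..b, (g v + g (a + b - v)) * Q v =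
      (∫ v in a..b, g v * Q v) + ∫ v in a..b, g (a + b - v) * Q (a + b - v) := by
    rw [← intervalIntegral.integral_add (hii (by fun_prop)) (hii (by fun_prop))]
    refine intervalIntegral.integral_congr fun v _ => ?_
    simp only [hC]
    ring
  have hQg : ∫ v in a..b, g v * Q v = ∫ v in a..b, g v * ((v - a) * (v - b)) := by
    have : ∀ v, g v * Q v = g v * ((v - a) * (v - b)) + g v * C := fun v => by rw [hC]; ring
    simp only [this]
    rw [intervalIntegral.integral_add (hii (by fun_prop)) (hii (by fun_prop)),
      intervalIntegral.integral_mul_const, h, zero_mul, add_zero]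
  rw [hsplit, hrefl fun v => g v * Q v, hQg] at hpos
  intro h0
  rw [h0] at hpos
  simp at hpos

/-- Since `c = c₀ + α x₁` is strictly monotone, it can replace time: `g dc = -|α| sinh θ ds`. The
mean of `g` is then a multiple of `x₂`, and its moment a multiple of `∫ x₁ (x₁ - x₁(T)) dx₂`, which
equals `2z - x₁y` when `x₂(T) = 0`. -/
theorem IsExtremal.two_mul_z_ne {l : Covector} {T : ℝ} {θ c : ℝ → ℝ} {q : ℝ → Fin 4 → ℝ}
    (hT : 0 < T) (hα : l.α ≠ 0) (h : IsExtremal l T θ c q) (hx : q T 1 = 0) :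
    2 * q T 3 ≠ q T 0 * q T 2 := by
  have hTm : T ∈ Icc 0 T := right_mem_Icc.2 hT.le
  have hx₁ : ∀ s ∈ Icc 0 T, c s = l.c + l.α * q s 0 := by
    refine eq_of_hasDerivWithinAt_eq h.deriv_c (fun s hs => ?_) (by simp [h.c_zero, h.q_zero])
    exact (((h.deriv_x₁ s hs).const_mul l.α).const_add l.c).congr_deriv (by ring)
  have hne : l.c ≠ c T := by
    have := strictAntiOn_of_hasDerivWithinAt_Icc h.deriv_x₁
      (fun s _ => neg_lt_zero.2 (cosh_pos _)) (left_mem_Icc.2 hT.le) hTm hT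
    simp only [h.q_zero, Pi.zero_apply] at this
    rw [hx₁ T hTm]
    intro h0
    have := mul_ne_zero hα this.ne
    exact this (by linarith)
  set g : ℝ → ℝ := fun v => (v ^ 2 / 2 - l.energy) / √(l.α ^ 2 + (v ^ 2 / 2 - l.energy) ^ 2)
  have hgc : Continuous g := Continuous.div (by fun_prop) (by fun_prop)
    fun v => (sqrt_pos.2 (by positivity)).ne'
  have hgθ : ∀ s ∈ Icc 0 T, g (c s) * (-l.α * cosh (θ s)) = -|l.α| * sinh (θ s) := by
    intro s hs
    have e := h.energy_eq s hs
    have hP : c s ^ 2 / 2 - l.energy = l.α * sinh (θ s) := by linarith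
    have hsq : √(l.α ^ 2 + (l.α * sinh (θ s)) ^ 2) = |l.α| * cosh (θ s) := by
      rw [show l.α ^ 2 + (l.α * sinh (θ s)) ^ 2 = (l.α * cosh (θ s)) ^ 2 by
        rw [mul_pow, mul_pow, cosh_sq]; ring, sqrt_sq_eq_abs, abs_mul, abs_of_pos (cosh_pos _)]
    have h1 := cosh_pos (θ s)
    have h2 := abs_pos.2 hα
    simp only [g]
    rw [hP, hsq]
    field_simp
    rw [sq_abs]
    ring
  have prim : ∀ {f : ℝ → ℝ}, Continuous f → ∀ s ∈ Icc 0 T,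
      HasDerivWithinAt (fun s => ∫ v in l.c..c s, f v) (f (c s) * (-l.α * cosh (θ s)))
        (Icc 0 T) s := fun {f} hf s hs =>
    (hf.integral_hasStrictDerivAt l.c (c s)).hasDerivAt.comp_hasDerivWithinAt s (h.deriv_c s hs)
  have hmean : ∫ v in l.c..c T, g v = 0 := by
    have := eq_of_hasDerivWithinAt_eq (prim hgc)
      (fun s hs => by rw [hgθ s hs]; exact (h.deriv_x₂ s hs).const_mul (-|l.α|))
      (by simp [h.c_zero, h.q_zero]) T hTm
    simpa [hx] using this
  have hmoment := integral_mul_ne_zero hα hne hmean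
  change ∫ v in l.c..c T, g v * ((v - l.c) * (v - c T)) ≠ 0 at hmoment
  have := eq_of_hasDerivWithinAt_eq
    (prim (f := fun v => g v * ((v - l.c) * (v - c T))) (by fun_prop))
    -- Here `y + x₁x₂/2` is a primitive of `x₁ dx₂`, and `2z - x₂³/3` of `x₁² dx₂`.
    (g := fun s => -|l.α| * l.α ^ 2 * (2 * q s 3 - q T 0 * (q s 2 + q s 0 * q s 1 / 2)
      - q s 1 ^ 3 / 3))
    (fun s hs => by
      have hd := (((((h.deriv_z s hs).const_mul 2).sub
        (((h.deriv_y s hs).add (((h.deriv_x₁ s hs).mul (h.deriv_x₂ s hs)).div_const 2)).const_mul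
          (q T 0))).sub (((h.deriv_x₂ s hs).pow 3).div_const 3)).const_mul (-|l.α| * l.α ^ 2))
      refine hd.congr_deriv ?_
      rw [mul_right_comm (g (c s)), hgθ s hs, hx₁ s hs, hx₁ T hTm]
      push_cast
      ring)
    (by simp [h.c_zero, h.q_zero]) T hTm
  intro hz
  apply hmoment
  rw [this, hx]
  simp [hz]

/-! ### Maxwell sets -/

theorem exists_isExtremal_of_mem_N {l : Covector} (hα : l.α ≠ 0) {t : ℝ} (h : (l, t) ∈ N) :
    ∃ θ c q, IsExtremal l t θ c q := by
  obtain ⟨θ, c, hv⟩ := exists_isVertical_of_lt_tSup hα h.2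
  obtain ⟨q, hq⟩ := hv.exists_isExtremal h.1.le
  exact ⟨θ, c, q, hq⟩

theorem not_mem_MAX1 {l : Covector} (hα : l.α ≠ 0) (t : ℝ) : (l, t) ∉ MAX1 := by
  rintro ⟨hN, -, hexp⟩
  have ht : 0 < t := hN.1
  obtain ⟨θ, c, q, h⟩ := exists_isExtremal_of_mem_N hα hN
  rw [reflect1, h.eps1.exp_eq ht.le, h.exp_eq ht.le] at hexp
  have h1 : -q t 1 = q t 1 := congrFun hexp 1
  have h2 : -q t 2 = q t 2 := congrFun hexp 2
  have h3 : -q t 3 = q t 3 := congrFun hexp 3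
  refine h.two_mul_z_ne ht hα (by linarith) ?_
  rw [show q t 2 = 0 by linarith, show q t 3 = 0 by linarith]
  ring

theorem not_mem_MAX2 {l : Covector} (hα : l.α ≠ 0) (t : ℝ) : (l, t) ∉ MAX2 := by
  rintro ⟨hN, hne, hexp⟩
  have ht : 0 < t := hN.1
  obtain ⟨θ, c, q, h⟩ := exists_isExtremal_of_mem_N hα hN
  obtain ⟨q', h', hq'⟩ := h.reverse ht.le
  simp only [reflect2, h.verticalFlow_eq ht.le, eps2] at hne hexp
  rw [h'.exp_eq ht.le, h.exp_eq ht.le, hq'] at hexp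
  have h2 : -q t 2 = q t 2 := congrFun hexp 2
  obtain ⟨m, rfl⟩ : ∃ m, t = 2 * m := ⟨t / 2, by ring⟩
  have hm : 0 < m := by linarith
  by_cases hc : c m = 0
  · obtain ⟨e1, e2⟩ := h.symm_of_mid_eq_zero hm.le hc
    exact hne (by rw [e1, e2, neg_neg])
  · exact h.y_ne_zero hm hc (by linarith)

theorem not_mem_MAX3 {l : Covector} (hα : l.α ≠ 0) (t : ℝ) : (l, t) ∉ MAX3 := by
  rintro ⟨hN, -, hexp⟩
  have ht : 0 < t := hN.1
  obtain ⟨θ, c, q, h⟩ := exists_isExtremal_of_mem_N hα hN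
  obtain ⟨q', h', hq'⟩ := h.reverse ht.le
  -- This expresses `ε³` after the flow as `ε¹` applied to the reversed covector, so both endpoint
  -- formulas compose.
  have h3 : eps3 ⟨θ t, c t, l.α⟩ = eps1 ⟨θ t, -c t, l.α⟩ := by simp [eps3, eps1]
  simp only [reflect3, h.verticalFlow_eq ht.le] at hexp
  rw [h3, h'.eps1.exp_eq ht.le, h.exp_eq ht.le, hq'] at hexp
  have e1 : -q t 1 = q t 1 := congrFun hexp 1
  have e3 : -(q t 3 - q t 0 * q t 2) = q t 3 := congrFun hexp 3
  exact h.two_mul_z_ne ht hα (by linarith) (by linarith)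

theorem α_ne_zero_of_mem {l : Covector} (h : l ∈ Cplus ∪ Cminus) : l.α ≠ 0 :=
  h.elim (fun h => ne_of_gt h) fun h => ne_of_lt h

end EngelTimelike

theorem mainTheorem6 :
    (EngelTimelike.MAX2 ∩ EngelTimelike.Npm = ∅) ∧
    (∀ l ∈ EngelTimelike.Cplus ∪ EngelTimelike.Cminus,
      ∀ p ∈ Set.Ioo 0 (EngelTimelike.ellipticK l.k), 0 < EngelTimelike.fy l p) ∧
    (∀ l ∈ EngelTimelike.Cplus ∪ EngelTimelike.Cminus,
      ∀ t : ℝ, 0 < t → (t : EReal) < EngelTimelike.tSup l →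
        (l, t) ∉ EngelTimelike.MAX1 ∧ (l, t) ∉ EngelTimelike.MAX2 ∧
          (l, t) ∉ EngelTimelike.MAX3) := by
  refine ⟨?_, fun l hl p hp => EngelTimelike.fy_pos (EngelTimelike.α_ne_zero_of_mem hl) hp,
    fun l hl t _ _ => ?_⟩
  · refine Set.eq_empty_iff_forall_notMem.2 fun ν hν => ?_
    exact EngelTimelike.not_mem_MAX2 (EngelTimelike.α_ne_zero_of_mem hν.2.2) ν.2 hν.1
  · have hα := EngelTimelike.α_ne_zero_of_mem hl
    exact ⟨EngelTimelike.not_mem_MAX1 hα t, EngelTimelike.not_mem_MAX2 hα t,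
      EngelTimelike.not_mem_MAX3 hα t⟩
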